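/- Let $\mathcal X$ and $\mathcal Y$ be metric spaces with Borel $\sigma$-fields $\mathcal F=\mathcal B(\mathcal X)$ and $\mathcal G=\mathcal B(\mathcal Y)$, and let $\mu$ on $\mathcal F$ and $\nu$ on $\mathcal G$ be probability measures. A probability measure is called separable if it gives mass $1$ to some measurable separable subset. Let $L_1(\mu)$ be the set of all measurable and $\mu$-integrable functions $f:\mathcal X\to\mathbb R$, and define $L_1(\nu)$ in the same way. Let $\Gamma(\mu,\nu)$ be the set of probability measures $P$ on the product $\sigma$-field $\mathcal F\otimes\mathcal G$ with marginals $\mu$ and $\nu$. Let $c:\mathcal X\times\mathcal Y\to\mathbb R$ be a function, not assumed to be $\mathcal F\otimes\mathcal G$-measurable, such that for some $f_1,f_2\in L_1(\mu)$ and $g_1,g_2\in L_1(\nu)$ $$f_1(x)+g_1(y)\le c(x,y)\le f_2(x)+g_2(y)\quad\text{for all }(x,y)\in\mathcal X\times\mathcal Y ,$$ and suppose that at least one of $\mu$ and $\nu$ is separable. Put $$\alpha(c)=\inf_{P\in\Gamma(\mu,\nu)}\int c\,dP,\qquad \alpha^*(c)=\sup_{P\in\Gamma(\mu,\nu)}\int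 c\,dP,$$ $$\beta(c)=\sup\Bigl\{\int f\,d\mu+\int g\,d\nu:\ f\in L_1(\mu),\ g\in L_1(\nu),\ f(x)+g(y)\le c(x,y)\text{ for all }x,y\Bigr\},$$ $$\beta^*(c)=\inf\Bigl\{\int f\,d\mu+\int g\,d\nu:\ f\in L_1(\mu),\ g\in L_1(\nu),\ f(x)+g(y)\ge c(x,y)\text{ for all }x,y\Bigr\},$$ where $\int c\,dP$ is the integral with respect to the completion of $P$. If $c$ is lower-semicontinuous with respect to the product topology on $\mathcal X\times\mathcal Y$, then $c$ is integrable with respect to the completion of every $P\in\Gamma(\mu,\nu)$, and $\alpha^*(c)=\beta^*(c)$. If $c$ is upper-semicontinuous with respect to the product topology, then $c$ is integrable with respect to the completion of every $P\in\Gamma(\mu,\nu)$, and $\alpha(c)=\beta(c)$. -/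

import Mathlib

open MeasureTheory Set

namespace KantorovichDuality

/-- A probability measure `μ` on a metric space is separable if it gives full mass to some
measurable separable set. -/
def SeparableMeasure {Ω : Type*} [TopologicalSpace Ω] [MeasurableSpace Ω] (μ : Measure Ω) : Prop :=
  ∃ A : Set Ω, MeasurableSet A ∧ TopologicalSpace.IsSeparable A ∧ μ A = 1

variable {X Y : Type*} [MeasurableSpace X] [MeasurableSpace Y]

/-- `L₁(μ)`: everywhere defined, real-valued functions that are measurable and integrable
(functions, not almost-everywhere classes). -/
def L1 (μ : Measure X) : Set (X → ℝ) :=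
  {f | Measurable f ∧ Integrable f μ}

/-- `Γ(μ, ν)`: the probability measures on the product σ-algebra with marginals `μ` and `ν`. -/
def couplings (μ : Measure X) (ν : Measure Y) : Set (Measure (X × Y)) :=
  {P | IsProbabilityMeasure P ∧ P.fst = μ ∧ P.snd = ν}

/-- Integrable bounds: `f₁ + g₁ ≤ c ≤ f₂ + g₂` pointwise, for some `f₁, f₂ ∈ L₁(μ)` and
`g₁, g₂ ∈ L₁(ν)`. -/
def IntegrableBounds (μ : Measure X) (ν : Measure Y) (c : X × Y → ℝ) : Prop :=
  ∃ f₁ ∈ L1 μ, ∃ g₁ ∈ L1 ν, ∃ f₂ ∈ L1 μ, ∃ g₂ ∈ L1 ν,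
    ∀ x y, f₁ x + g₁ y ≤ c (x, y) ∧ c (x, y) ≤ f₂ x + g₂ y

/-- `α(c) = inf {P(c) : P ∈ Γ(μ, ν)}`. The Bochner integral only asks `c` to agree `P`-almost
everywhere with a measurable function, so `∫ z, c z ∂P` is the integral of `c` with respect to
the completion of `P`. Infima and suprema are taken in the extended reals, where they exist. -/
noncomputable def alpha (μ : Measure X) (ν : Measure Y) (c : X × Y → ℝ) : EReal :=
  ⨅ P ∈ couplings μ ν, ((∫ z, c z ∂P : ℝ) : EReal)

/-- `α*(c) = sup {P(c) : P ∈ Γ(μ, ν)}`. -/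
noncomputable def alphaStar (μ : Measure X) (ν : Measure Y) (c : X × Y → ℝ) : EReal :=
  ⨆ P ∈ couplings μ ν, ((∫ z, c z ∂P : ℝ) : EReal)

/-- `β(c) = sup {μ(f) + ν(g) : f ∈ L₁(μ), g ∈ L₁(ν), f + g ≤ c}`. -/
noncomputable def beta (μ : Measure X) (ν : Measure Y) (c : X × Y → ℝ) : EReal :=
  sSup {r : EReal | ∃ f ∈ L1 μ, ∃ g ∈ L1 ν, (∀ x y, f x + g y ≤ c (x, y)) ∧
    r = ((∫ x, f x ∂μ + ∫ y, g y ∂ν : ℝ) : EReal)}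

/-- `β*(c) = inf {μ(f) + ν(g) : f ∈ L₁(μ), g ∈ L₁(ν), f + g ≥ c}`. -/
noncomputable def betaStar (μ : Measure X) (ν : Measure Y) (c : X × Y → ℝ) : EReal :=
  sInf {r : EReal | ∃ f ∈ L1 μ, ∃ g ∈ L1 ν, (∀ x y, c (x, y) ≤ f x + g y) ∧
    r = ((∫ x, f x ∂μ + ∫ y, g y ∂ν : ℝ) : EReal)}

end KantorovichDuality

/-! Passing to -c exchanges the two halves, so let c be lower-semicontinuous. Integrating c ≤ f + g
against a coupling gives α* ≤ β*. For the converse, the integrable bounds reduce matters to 0 ≤ c ≤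
M: clamping c costs at most the tails of an integrable majorant F + G of |c|.

Separability of one marginal makes every set {c > t} a countable union of measurable rectangles over
a product A × B of full-measure sets (`exists_seq_rectangles`). So c is measurable modulo null sets,
and over A × B it is the increasing limit of costs c_k ≤ c, each constant on the cells of a finite
product partition. For c_k duality is finite-dimensional (`exists_dual_of_finite_transport`, by
Hahn-Banach), because a plan between the cell masses lifts to a coupling. A strict upper bound r for
all ∫ c dP also bounds all ∫ c_k dP, so c_k has dual potentials with values in [0, M] and total
integral at most r.

It remains to let k → ∞ (`exists_dual_of_monotone`). The admissible pairs for c_k form a decreasing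
sequence of bounded convex sets in L². Nearly norm-minimal elements are Cauchy, and a subsequence
converges almost everywhere. The limit dominates every c_k, hence c, outside a null set in each
factor; on these null sets the potentials are raised to M. The approximation is from below while α*
is a supremum, so no compactness of the set of couplings is needed. -/

namespace KantorovichDuality

/-! ### Convexity tools and finite transport duality -/

/-- Mazur-type selection: a decreasing sequence of nonempty, bounded, convex subsets of an inner
product space admits a Cauchy sequence of selections. -/
theorem exists_cauchySeq_mem_of_antitone_convex {H : Type*} [NormedAddCommGroup H]
    [InnerProductSpace ℝ H] {S : ℕ → Set H} (hanti : Antitone S) (hne : ∀ k, (S k).Nonempty)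
    (hconv : ∀ k, Convex ℝ (S k)) {R : ℝ} (hR : ∀ k, ∀ h ∈ S k, ‖h‖ ≤ R) :
    ∃ h : ℕ → H, (∀ k, h k ∈ S k) ∧ CauchySeq h := by
  set d : ℕ → ℝ := fun k => sInf ((fun h => ‖h‖ ^ 2) '' S k) with hd
  have hbdd : ∀ k, BddBelow ((fun h => ‖h‖ ^ 2) '' S k) := fun k =>
    ⟨0, by rintro _ ⟨h, -, rfl⟩; positivity⟩
  have hd_le : ∀ k, ∀ h ∈ S k, d k ≤ ‖h‖ ^ 2 := fun k h hh => csInf_le (hbdd k) ⟨h, hh, rfl⟩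
  have hmono : Monotone d := fun k l hkl =>
    csInf_le_csInf (hbdd k) ((hne l).image _) (image_mono (hanti hkl))
  have hdR : BddAbove (range d) := by
    refine ⟨R ^ 2, ?_⟩
    rintro _ ⟨k, rfl⟩
    obtain ⟨h, hh⟩ := hne k
    exact (hd_le k h hh).trans (pow_le_pow_left₀ (norm_nonneg _) (hR k h hh) 2)
  have hlim := tendsto_atTop_ciSup hmono hdR
  set D := ⨆ k, d k
  have hdD : ∀ k, d k ≤ D := fun k => le_ciSup hdR k
  have hex : ∀ k, ∃ h ∈ S k, ‖h‖ ^ 2 < d k + 1 / ((k : ℝ) + 1) := by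
    intro k
    obtain ⟨_, ⟨h, hh, rfl⟩, hlt⟩ := exists_lt_of_csInf_lt ((hne k).image (fun h => ‖h‖ ^ 2))
      (show d k < d k + 1 / ((k : ℝ) + 1) by have : 0 < 1 / ((k : ℝ) + 1) := by positivity
                                             linarith)
    exact ⟨h, hh, hlt⟩
  choose h hmem hlt using hex
  refine ⟨h, hmem, ?_⟩
  -- The midpoint lies in `S N`, so its squared norm is at least `d N`; the parallelogram law then
  -- bounds the distance between near-minimisers.
  have key : ∀ N k l, N ≤ k → N ≤ l →
      ‖h k - h l‖ ^ 2 ≤ 4 * (D - d N) + 4 * (1 / ((N : ℝ) + 1)) := by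
    intro N k l hk hl
    have hmid : (1 / 2 : ℝ) • h k + (1 / 2 : ℝ) • h l ∈ S N :=
      hconv N (hanti hk (hmem k)) (hanti hl (hmem l)) (by norm_num) (by norm_num) (by norm_num)
    have h1 := hd_le N _ hmid
    rw [← smul_add, norm_smul, mul_pow] at h1
    have h2 := parallelogram_law_with_norm ℝ (h k) (h l)
    have h3 : 1 / ((k : ℝ) + 1) ≤ 1 / ((N : ℝ) + 1) := by gcongr
    have h4 : 1 / ((l : ℝ) + 1) ≤ 1 / ((N : ℝ) + 1) := by gcongr
    have h5 := hlt k
    have h6 := hlt l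
    have h7 := hdD k
    have h8 := hdD l
    norm_num at h1
    nlinarith
  have hz : Filter.Tendsto (fun N : ℕ => 4 * (D - d N) + 4 * (1 / ((N : ℝ) + 1)))
      Filter.atTop (nhds 0) := by
    have := ((hlim.const_sub D).const_mul 4).add
      ((tendsto_one_div_add_atTop_nhds_zero_nat (𝕜 := ℝ)).const_mul 4)
    simpa using this
  rw [Metric.cauchySeq_iff]
  intro ε hε
  obtain ⟨N, hN⟩ := (hz.eventually (gt_mem_nhds (show (0 : ℝ) < ε ^ 2 by positivity))).exists
  refine ⟨N, fun k hk l hl => ?_⟩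
  rw [dist_eq_norm]
  exact lt_of_pow_lt_pow_left₀ 2 hε.le ((key N k l hk hl).trans_lt hN)

/-- Hahn-Banach: a sublinear functional is attained at any given point by a linear functional
that it dominates. -/
theorem exists_linearMap_eq_of_sublinear {E : Type*} [AddCommGroup E] [Module ℝ E] (N : E → ℝ)
    (N_hom : ∀ c : ℝ, 0 < c → ∀ x, N (c • x) = c * N x) (N_add : ∀ x y, N (x + y) ≤ N x + N y)
    (x₀ : E) : ∃ g : E →ₗ[ℝ] ℝ, g x₀ = N x₀ ∧ ∀ x, g x ≤ N x := by
  have N_0 : N 0 = 0 := by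
    have := N_hom 2 (by norm_num) 0
    rw [smul_zero] at this
    linarith
  by_cases hx : x₀ = 0
  · obtain ⟨g, -, hg⟩ := exists_extension_of_le_sublinear (⊥ : E →ₗ.[ℝ] ℝ) N N_hom N_add (by
      rintro ⟨x, hx⟩
      obtain rfl : x = 0 := (Submodule.mem_bot ℝ).1 hx
      rw [N_0]
      exact (LinearPMap.map_zero _).le)
    exact ⟨g, by rw [hx, N_0, map_zero], hg⟩
  · obtain ⟨g, hg, hgN⟩ := exists_extension_of_le_sublinear
      (LinearPMap.mkSpanSingleton x₀ (N x₀) hx) N N_hom N_add (by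
        rintro ⟨x, hx'⟩
        obtain ⟨t, rfl⟩ := Submodule.mem_span_singleton.1 hx'
        refine (LinearPMap.mkSpanSingleton'_apply ..).trans_le ?_
        rcases lt_trichotomy t 0 with ht | rfl | ht
        -- From 0 = N 0 ≤ N (t x₀) + N (-t x₀) one gets t N x₀ = -N (-t x₀) ≤ N (t x₀).
        · have h1 := N_add (t • x₀) ((-t) • x₀)
          rw [← add_smul, add_neg_cancel, zero_smul, N_0, N_hom (-t) (by linarith)] at h1
          show t * N x₀ ≤ N (t • x₀)
          linarith
        · show 0 * N x₀ ≤ N ((0 : ℝ) • x₀)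
          rw [zero_smul, N_0, zero_mul]
        · exact (N_hom t ht x₀).ge)
    refine ⟨g, ?_, hgN⟩
    have h1 := hg ⟨x₀, Submodule.mem_span_singleton_self x₀⟩
    rw [h1]
    exact LinearPMap.mkSpanSingleton_apply ℝ ..

open scoped Pointwise in
/-- Kantorovich duality for probability vectors. -/
theorem exists_dual_of_finite_transport {I J : Type*} [Fintype I] [Fintype J]
    {p : I → ℝ} {q : J → ℝ} (hp : ∀ a, 0 ≤ p a) (hq : ∀ b, 0 ≤ q b)
    (hp1 : ∑ a, p a = 1) (hq1 : ∑ b, q b = 1) (C : I → J → ℝ) {r : ℝ}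
    (hr : ∀ w : I → J → ℝ, (∀ a b, 0 ≤ w a b) → (∀ a, ∑ b, w a b = p a) →
      (∀ b, ∑ a, w a b = q b) → ∑ a, ∑ b, w a b * C a b < r) :
    ∃ u : I → ℝ, ∃ v : J → ℝ, (∀ a b, C a b ≤ u a + v b) ∧
      ∑ a, p a * u a + ∑ b, q b * v b < r := by
  classical
  -- The infimum of `S C` is sublinear in the cost. A linear functional below it that touches it at
  -- the given cost is an optimal plan: its values on the unit matrices are the weights.
  let S : (I → J → ℝ) → Set ℝ := fun C => {s | ∃ u : I → ℝ, ∃ v : J → ℝ,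
    (∀ a b, C a b ≤ u a + v b) ∧ s = ∑ a, p a * u a + ∑ b, q b * v b}
  have hne : ∀ C, (S C).Nonempty := by
    intro C
    refine ⟨_, fun a => ∑ b, |C a b|, fun _ => 0, fun a b => ?_, rfl⟩
    rw [add_zero]
    exact (le_abs_self _).trans
      (Finset.single_le_sum (f := fun b => |C a b|) (fun b _ => abs_nonneg _) (Finset.mem_univ b))
  have hbdd : ∀ C, BddBelow (S C) := by
    intro C
    -- Weak duality, tested on the product plan.
    refine ⟨∑ a, ∑ b, p a * q b * C a b, ?_⟩
    rintro _ ⟨u, v, huv, rfl⟩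
    have h1 : ∑ a, ∑ b, p a * q b * C a b ≤ ∑ a, ∑ b, p a * q b * (u a + v b) := by
      gcongr with a _ b _
      · exact mul_nonneg (hp a) (hq b)
      · exact huv a b
    refine h1.trans_eq ?_
    have h2 : ∑ a, ∑ b, p a * q b * u a = ∑ a, p a * u a := by
      refine Finset.sum_congr rfl fun a _ => ?_
      rw [← mul_one (p a * u a), ← hq1, Finset.mul_sum]
      exact Finset.sum_congr rfl fun b _ => by ring
    have h3 : ∑ a, ∑ b, p a * q b * v b = ∑ b, q b * v b := by
      rw [Finset.sum_comm]
      refine Finset.sum_congr rfl fun b _ => ?_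
      rw [← mul_one (q b * v b), ← hp1, Finset.mul_sum]
      exact Finset.sum_congr rfl fun a _ => by ring
    simp_rw [mul_add, Finset.sum_add_distrib, h2, h3]
  obtain ⟨g, hgC, hg⟩ := exists_linearMap_eq_of_sublinear (fun C => sInf (S C)) (by
      intro c hc C
      have : S (c • C) = c • S C := by
        ext s
        constructor
        · rintro ⟨u, v, huv, rfl⟩
          refine ⟨_, ⟨c⁻¹ • u, c⁻¹ • v, fun a b => ?_, rfl⟩, ?_⟩
          · have := huv a b
            simp only [Pi.smul_apply, smul_eq_mul] at this ⊢
            rw [← mul_add, inv_mul_eq_div, le_div_iff₀ hc]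
            linarith
          · simp only [Pi.smul_apply, smul_eq_mul, mul_add, Finset.mul_sum]
            congr 1 <;> exact Finset.sum_congr rfl fun a _ => by field_simp
        · rintro ⟨_, ⟨u, v, huv, rfl⟩, rfl⟩
          refine ⟨c • u, c • v, fun a b => ?_, ?_⟩
          · simp only [Pi.smul_apply, smul_eq_mul]
            rw [← mul_add]
            exact mul_le_mul_of_nonneg_left (huv a b) hc.le
          · simp only [Pi.smul_apply, smul_eq_mul, mul_add, Finset.mul_sum]
            congr 1 <;> exact Finset.sum_congr rfl fun a _ => by ring
      simp only [this, Real.sInf_smul_of_nonneg hc.le, smul_eq_mul]) (by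
      intro C C'
      rw [← csInf_add (hne C) (hbdd C) (hne C') (hbdd C')]
      refine csInf_le_csInf (hbdd _) ((hne C).add (hne C')) ?_
      rintro _ ⟨_, ⟨u, v, huv, rfl⟩, _, ⟨u', v', huv', rfl⟩, rfl⟩
      refine ⟨u + u', v + v', fun a b => ?_, ?_⟩
      · have := huv a b
        have := huv' a b
        simp only [Pi.add_apply]
        linarith
      · simp only [Pi.add_apply, mul_add, Finset.sum_add_distrib]
        ring) C
  have hg' : ∀ (C' : I → J → ℝ) (u : I → ℝ) (v : J → ℝ), (∀ a b, C' a b ≤ u a + v b) →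
      g C' ≤ ∑ a, p a * u a + ∑ b, q b * v b := fun C' u v huv =>
    (hg C').trans (csInf_le (hbdd C') ⟨u, v, huv, rfl⟩)
  -- The upper bound applied to a separated cost and to its negative forces equality; with
  -- indicators for u and v this gives the marginal constraints.
  have hgeq : ∀ (u : I → ℝ) (v : J → ℝ), g (fun a b => u a + v b) = ∑ a, p a * u a + ∑ b, q b * v b := by
    intro u v
    refine le_antisymm (hg' _ u v fun a b => le_rfl) ?_
    have := hg' (-fun a b => u a + v b) (-u) (-v) (fun a b => by
      simp only [Pi.neg_apply]; linarith)
    rw [map_neg] at this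
    simp only [Pi.neg_apply, mul_neg, Finset.sum_neg_distrib] at this
    linarith
  let e : I → J → I → J → ℝ := fun a b => Pi.single a (Pi.single b 1)
  have he : ∀ a b a' b', e a b a' b' = if a' = a ∧ b' = b then 1 else 0 := by
    intro a b a' b'
    by_cases h : a' = a
    · subst h; by_cases h' : b' = b
      · subst h'; simp [e]
      · simp [e, h']
    · simp [e, h]
  have hexp : ∀ C' : I → J → ℝ, C' = ∑ a, ∑ b, C' a b • e a b := by
    intro C'
    ext a' b'
    simp only [Finset.sum_apply, Pi.smul_apply, smul_eq_mul, he]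
    simp [ite_and]
  have hgsum : ∀ C' : I → J → ℝ, g C' = ∑ a, ∑ b, g (e a b) * C' a b := by
    intro C'
    conv_lhs => rw [hexp C']
    simp only [map_sum, map_smul, smul_eq_mul, mul_comm]
  have hlt := hr (fun a b => g (e a b)) (by
      intro a b
      have := hg' (-e a b) 0 0 (fun a' b' => by
        simp only [Pi.neg_apply, he, Pi.zero_apply]
        split_ifs <;> norm_num)
      rw [map_neg] at this
      simp only [Pi.zero_apply, mul_zero, Finset.sum_const_zero] at this
      linarith) (by
      intro a
      have := hgeq (Pi.single a 1) 0
      rw [hgsum] at this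
      simpa [Pi.single_apply] using this) (by
      intro b
      have := hgeq 0 (Pi.single b 1)
      rw [hgsum] at this
      simpa [Pi.single_apply] using this)
  rw [← hgsum, hgC] at hlt
  obtain ⟨_, ⟨u, v, huv, rfl⟩, hs⟩ := exists_lt_of_csInf_lt (hne C) hlt
  exact ⟨u, v, huv, hs⟩

end KantorovichDuality
-- Lifting finite plans to couplings
namespace KantorovichDuality
variable {X Y : Type*} [MeasurableSpace X] [MeasurableSpace Y]

theorem integral_comp_fintype {I : Type*} [Fintype I] [MeasurableSpace I]
    [MeasurableSingletonClass I] {μ : Measure X} [IsProbabilityMeasure μ] {i : X → I}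
    (hi : Measurable i) (u : I → ℝ) :
    ∫ x, u (i x) ∂μ = ∑ a, μ.real (i ⁻¹' {a}) * u a := by
  have : IsProbabilityMeasure (μ.map i) := Measure.isProbabilityMeasure_map hi.aemeasurable
  rw [← integral_map (f := u) hi.aemeasurable (measurable_of_finite u).aestronglyMeasurable,
    integral_fintype Integrable.of_finite]
  refine Finset.sum_congr rfl fun a _ => ?_
  rw [map_measureReal_apply hi (measurableSet_singleton a), smul_eq_mul]

/-- A transport plan between the laws of two finitely valued maps lifts to a coupling. -/
theorem exists_coupling_of_finite_transport {I J : Type*}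
    [Fintype I] [MeasurableSpace I] [MeasurableSingletonClass I]
    [Fintype J] [MeasurableSpace J] [MeasurableSingletonClass J]
    (μ : Measure X) [IsProbabilityMeasure μ] (ν : Measure Y) [IsProbabilityMeasure ν]
    {i : X → I} (hi : Measurable i) {j : Y → J} (hj : Measurable j) (w : I → J → ℝ)
    (hw : ∀ a b, 0 ≤ w a b) (hw₁ : ∀ a, ∑ b, w a b = μ.real (i ⁻¹' {a}))
    (hw₂ : ∀ b, ∑ a, w a b = ν.real (j ⁻¹' {b})) :
    ∃ P ∈ couplings μ ν, ∀ C : I → J → ℝ,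
      ∫ z, C (i z.1) (j z.2) ∂P = ∑ a, ∑ b, w a b * C a b := by
  have hAm : ∀ a, MeasurableSet (i ⁻¹' {a}) := fun a => hi (measurableSet_singleton a)
  have hBm : ∀ b, MeasurableSet (j ⁻¹' {b}) := fun b => hj (measurableSet_singleton b)
  -- Conditioning on a null cell gives the zero measure, not a probability. This is harmless, since
  -- the marginal constraints make the weight of such a cell vanish.
  have hA : ∀ a b, μ (i ⁻¹' {a}) = 0 → w a b = 0 := by
    intro a b h
    refine le_antisymm ?_ (hw a b)
    refine (Finset.single_le_sum (fun b _ => hw a b) (Finset.mem_univ b)).trans ?_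
    rw [hw₁, measureReal_def, h, ENNReal.toReal_zero]
  have hB : ∀ a b, ν (j ⁻¹' {b}) = 0 → w a b = 0 := by
    intro a b h
    refine le_antisymm ?_ (hw a b)
    refine (Finset.single_le_sum (fun a _ => hw a b) (Finset.mem_univ a)).trans ?_
    rw [hw₂, measureReal_def, h, ENNReal.toReal_zero]
  have hA1 : ∀ a b, ENNReal.ofReal (w a b) * ProbabilityTheory.cond μ (i ⁻¹' {a}) univ =
      ENNReal.ofReal (w a b) := by
    intro a b
    by_cases h : μ (i ⁻¹' {a}) = 0
    · rw [hA a b h, ENNReal.ofReal_zero, zero_mul]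
    · have := ProbabilityTheory.cond_isProbabilityMeasure h
      rw [measure_univ, mul_one]
  have hB1 : ∀ a b, ENNReal.ofReal (w a b) * ProbabilityTheory.cond ν (j ⁻¹' {b}) univ =
      ENNReal.ofReal (w a b) := by
    intro a b
    by_cases h : ν (j ⁻¹' {b}) = 0
    · rw [hB a b h, ENNReal.ofReal_zero, zero_mul]
    · have := ProbabilityTheory.cond_isProbabilityMeasure h
      rw [measure_univ, mul_one]
  have hs1 : ∀ a, ∑ b, ENNReal.ofReal (w a b) = μ (i ⁻¹' {a}) := by
    intro a
    rw [← ENNReal.ofReal_sum_of_nonneg (fun b _ => hw a b), hw₁, ofReal_measureReal]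
  have hs2 : ∀ b, ∑ a, ENNReal.ofReal (w a b) = ν (j ⁻¹' {b}) := by
    intro b
    rw [← ENNReal.ofReal_sum_of_nonneg (fun a _ => hw a b), hw₂, ofReal_measureReal]
  -- Within each cell the mass `w a b` is spread as a product of conditional laws.
  let P : Measure (X × Y) := ∑ a, ∑ b, ENNReal.ofReal (w a b) •
    (ProbabilityTheory.cond μ (i ⁻¹' {a})).prod (ProbabilityTheory.cond ν (j ⁻¹' {b}))
  have hP : ∀ (s : Set X) (t : Set Y), P (s ×ˢ t) = ∑ a, ∑ b, ENNReal.ofReal (w a b) *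
      (ProbabilityTheory.cond μ (i ⁻¹' {a}) s * ProbabilityTheory.cond ν (j ⁻¹' {b}) t) := by
    intro s t
    simp only [P, Measure.coe_finsetSum, Finset.sum_apply, Measure.smul_apply, smul_eq_mul,
      Measure.prod_prod]
  have hfst : P.fst = μ := by
    ext s hs
    rw [Measure.fst_apply hs, ← prod_univ, hP]
    conv_rhs => rw [← ProbabilityTheory.sum_meas_smul_cond_fiber hi μ]
    simp only [Measure.coe_finsetSum, Finset.sum_apply, Measure.smul_apply, smul_eq_mul]
    refine Finset.sum_congr rfl fun a _ => ?_
    rw [← hs1, Finset.sum_mul]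
    refine Finset.sum_congr rfl fun b _ => ?_
    rw [mul_comm (ProbabilityTheory.cond μ _ s), ← mul_assoc, hB1]
  have hsnd : P.snd = ν := by
    ext t ht
    rw [Measure.snd_apply ht, ← univ_prod, hP, Finset.sum_comm]
    conv_rhs => rw [← ProbabilityTheory.sum_meas_smul_cond_fiber hj ν]
    simp only [Measure.coe_finsetSum, Finset.sum_apply, Measure.smul_apply, smul_eq_mul]
    refine Finset.sum_congr rfl fun b _ => ?_
    rw [← hs2, Finset.sum_mul]
    refine Finset.sum_congr rfl fun a _ => ?_
    rw [← mul_assoc, hA1]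
  refine ⟨P, ⟨⟨?_⟩, hfst, hsnd⟩, fun C => ?_⟩
  · rw [← Measure.fst_univ, hfst, measure_univ]
  have hCm : Measurable fun z : X × Y => C (i z.1) (j z.2) :=
    (measurable_of_finite (fun ab : I × J => C ab.1 ab.2)).comp
      ((hi.comp measurable_fst).prodMk (hj.comp measurable_snd))
  have hCb : ∃ K, ∀ a b, ‖C a b‖ ≤ K := by
    refine ⟨∑ a, ∑ b, ‖C a b‖, fun a b => ?_⟩
    exact (Finset.single_le_sum (f := fun b => ‖C a b‖) (fun b _ => norm_nonneg _)
      (Finset.mem_univ b)).trans (Finset.single_le_sum (f := fun a => ∑ b, ‖C a b‖)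
      (fun a _ => Finset.sum_nonneg fun b _ => norm_nonneg _) (Finset.mem_univ a))
  obtain ⟨K, hK⟩ := hCb
  have hint : ∀ a b, Integrable (fun z : X × Y => C (i z.1) (j z.2)) (ENNReal.ofReal (w a b) •
      (ProbabilityTheory.cond μ (i ⁻¹' {a})).prod (ProbabilityTheory.cond ν (j ⁻¹' {b}))) :=
    fun a b => (Integrable.of_bound hCm.aestronglyMeasurable K
      (ae_of_all _ fun z => hK _ _)).smul_measure ENNReal.ofReal_ne_top
  rw [integral_finsetSum_measure fun a _ => integrable_finsetSum_measure.2 fun b _ => hint a b]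
  refine Finset.sum_congr rfl fun a _ => ?_
  rw [integral_finsetSum_measure fun b _ => hint a b]
  refine Finset.sum_congr rfl fun b _ => ?_
  by_cases h0 : w a b = 0
  · simp [h0]
  have hμ := ProbabilityTheory.cond_isProbabilityMeasure (fun h => h0 (hA a b h))
  have hν := ProbabilityTheory.cond_isProbabilityMeasure (fun h => h0 (hB a b h))
  have hae : (fun z : X × Y => C (i z.1) (j z.2)) =ᵐ[(ProbabilityTheory.cond μ
      (i ⁻¹' {a})).prod (ProbabilityTheory.cond ν (j ⁻¹' {b}))] fun _ => C a b := by
    have h1 := (Measure.quasiMeasurePreserving_fst (μ := ProbabilityTheory.cond μ (i ⁻¹' {a}))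
      (ν := ProbabilityTheory.cond ν (j ⁻¹' {b}))).ae (ProbabilityTheory.ae_cond_mem (hAm a))
    have h2 := (Measure.quasiMeasurePreserving_snd (μ := ProbabilityTheory.cond μ (i ⁻¹' {a}))
      (ν := ProbabilityTheory.cond ν (j ⁻¹' {b}))).ae (ProbabilityTheory.ae_cond_mem (hBm b))
    filter_upwards [h1, h2] with z hz1 hz2
    rw [show i z.1 = a from hz1, show j z.2 = b from hz2]
  rw [integral_smul_measure, integral_congr_ae hae, integral_const, ENNReal.toReal_ofReal (hw a b)]
  simp

/-- Every plan between the cell masses is induced by a coupling, so a bound over couplings is a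
bound over finite plans. -/
theorem exists_dual_of_finite_partition {I J : Type*}
    [Fintype I] [MeasurableSpace I] [MeasurableSingletonClass I]
    [Fintype J] [MeasurableSpace J] [MeasurableSingletonClass J]
    (μ : Measure X) [IsProbabilityMeasure μ] (ν : Measure Y) [IsProbabilityMeasure ν]
    {i : X → I} (hi : Measurable i) {j : Y → J} (hj : Measurable j) (C : I → J → ℝ) {r : ℝ}
    (hr : ∀ P ∈ couplings μ ν, ∫ z, C (i z.1) (j z.2) ∂P < r) :
    ∃ u : I → ℝ, ∃ v : J → ℝ, (∀ a b, C a b ≤ u a + v b) ∧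
      ∫ x, u (i x) ∂μ + ∫ y, v (j y) ∂ν < r := by
  simp_rw [integral_comp_fintype hi, integral_comp_fintype hj]
  refine exists_dual_of_finite_transport (fun _ => measureReal_nonneg)
    (fun _ => measureReal_nonneg) ?_ ?_ C fun w hw hw₁ hw₂ => ?_
  · simpa using (integral_comp_fintype (μ := μ) hi fun _ => 1).symm
  · simpa using (integral_comp_fintype (μ := ν) hj fun _ => 1).symm
  · obtain ⟨P, hP, hint⟩ := exists_coupling_of_finite_transport μ ν hi hj w hw hw₁ hw₂
    rw [← hint C]
    exact hr P hP

end KantorovichDuality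
-- Separability and countable unions of rectangles
namespace KantorovichDuality

/-- The balls of radius 1/(k+1) around a countable set whose closure contains `A` suffice, although
`X` itself may have no countable basis. -/
theorem exists_seq_isOpen_basis_of_isSeparable {X : Type*} [MetricSpace X] {A : Set X}
    (hA : TopologicalSpace.IsSeparable A) (hne : A.Nonempty) :
    ∃ U : ℕ → Set X, (∀ n, IsOpen (U n)) ∧
      ∀ x ∈ A, ∀ O, IsOpen O → x ∈ O → ∃ n, x ∈ U n ∧ U n ⊆ O := by
  obtain ⟨s, hs, hAs⟩ := hA
  have hsne : s.Nonempty := closure_nonempty_iff.1 (hne.mono hAs)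
  obtain ⟨d, rfl⟩ := hs.exists_eq_range hsne
  refine ⟨fun n => Metric.ball (d n.unpair.1) (1 / ((n.unpair.2 : ℝ) + 1)),
    fun n => Metric.isOpen_ball, fun x hx O hO hxO => ?_⟩
  obtain ⟨ε, hε, hεO⟩ := Metric.isOpen_iff.1 hO x hxO
  obtain ⟨k, hk⟩ := exists_nat_one_div_lt (half_pos hε)
  obtain ⟨_, ⟨m, rfl⟩, hm⟩ := Metric.mem_closure_iff.1 (hAs hx) (1 / ((k : ℝ) + 1))
    (by positivity)
  refine ⟨Nat.pair m k, ?_, fun z hz => hεO ?_⟩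
  · simpa using hm
  · simp only [Nat.unpair_pair, Metric.mem_ball] at hz ⊢
    have := dist_triangle_right z x (d m)
    linarith

/-- If `A` is separable, every open subset of the product agrees over `A` with a countable union
of open rectangles. -/
theorem exists_seq_rectangles_of_isSeparable {X Y : Type*} [MetricSpace X] [TopologicalSpace Y]
    {A : Set X} (hA : TopologicalSpace.IsSeparable A) (hne : A.Nonempty)
    {W : Set (X × Y)} (hW : IsOpen W) :
    ∃ (U : ℕ → Set X) (V : ℕ → Set Y), (∀ n, IsOpen (U n)) ∧ (∀ n, IsOpen (V n)) ∧
      (∀ n x y, x ∈ U n → y ∈ V n → (x, y) ∈ W) ∧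
      ∀ x ∈ A, ∀ y, (x, y) ∈ W → ∃ n, x ∈ U n ∧ y ∈ V n := by
  obtain ⟨U, hU, hbasis⟩ := exists_seq_isOpen_basis_of_isSeparable hA hne
  -- Taking the largest open `V` with U n × V ⊆ W removes any need for countability in the second
  -- factor.
  refine ⟨U, fun n => ⋃₀ {V | IsOpen V ∧ U n ×ˢ V ⊆ W}, hU,
    fun n => isOpen_sUnion fun V hV => hV.1, ?_, ?_⟩
  · rintro n x y hx ⟨V, ⟨-, hVW⟩, hy⟩
    exact hVW ⟨hx, hy⟩
  · intro x hx y hxy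
    obtain ⟨O, V, hO, hV, hxO, hyV, hOV⟩ := isOpen_prod_iff.1 hW x y hxy
    obtain ⟨n, hxn, hn⟩ := hbasis x hx O hO hxO
    exact ⟨n, hxn, V, ⟨hV, (prod_mono hn Subset.rfl).trans hOV⟩, hyV⟩

/-- The sets `A` and `B` are chosen before `W`, so one null set per factor serves all superlevel
sets of a cost and all couplings. -/
theorem exists_seq_rectangles {X Y : Type*}
    [MetricSpace X] [MeasurableSpace X] [BorelSpace X]
    [MetricSpace Y] [MeasurableSpace Y] [BorelSpace Y]
    (μ : Measure X) [IsProbabilityMeasure μ] (ν : Measure Y) [IsProbabilityMeasure ν]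
    (hsep : SeparableMeasure μ ∨ SeparableMeasure ν) :
    ∃ (A : Set X) (B : Set Y), MeasurableSet A ∧ MeasurableSet B ∧ μ Aᶜ = 0 ∧ ν Bᶜ = 0 ∧
      ∀ W : Set (X × Y), IsOpen W → ∃ (U : ℕ → Set X) (V : ℕ → Set Y),
        (∀ n, MeasurableSet (U n)) ∧ (∀ n, MeasurableSet (V n)) ∧
        (∀ n x y, x ∈ U n → y ∈ V n → (x, y) ∈ W) ∧
        ∀ x ∈ A, ∀ y ∈ B, (x, y) ∈ W → ∃ n, x ∈ U n ∧ y ∈ V n := by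
  rcases hsep with ⟨A, hAm, hA, h1⟩ | ⟨B, hBm, hB, h1⟩
  · have hne : A.Nonempty := nonempty_of_measure_ne_zero (μ := μ) (by simp [h1])
    refine ⟨A, univ, hAm, .univ, (prob_compl_eq_zero_iff hAm).2 h1, by simp, fun W hW => ?_⟩
    obtain ⟨U, V, hU, hV, hUV, hW'⟩ := exists_seq_rectangles_of_isSeparable hA hne hW
    exact ⟨U, V, fun n => (hU n).measurableSet, fun n => (hV n).measurableSet, hUV,
      fun x hx y _ => hW' x hx y⟩
  · have hne : B.Nonempty := nonempty_of_measure_ne_zero (μ := ν) (by simp [h1])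
    refine ⟨univ, B, .univ, hBm, by simp, (prob_compl_eq_zero_iff hBm).2 h1, fun W hW => ?_⟩
    obtain ⟨V, U, hV, hU, hUV, hW'⟩ := exists_seq_rectangles_of_isSeparable hB hne
      (hW.preimage continuous_swap)
    refine ⟨U, V, fun n => (hU n).measurableSet, fun n => (hV n).measurableSet,
      fun n x y hx hy => hUV n y x hy hx, fun x _ y hy hxy => ?_⟩
    obtain ⟨n, hn⟩ := hW' y hy x hxy
    exact ⟨n, hn.2, hn.1⟩

end KantorovichDuality
-- Measurability, and limits and normalisation of dual potentials
namespace KantorovichDuality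
variable {X Y : Type*} [MeasurableSpace X] [MeasurableSpace Y]

theorem ae_fst_of_mem_couplings {μ : Measure X} {ν : Measure Y} {P : Measure (X × Y)}
    (hP : P ∈ couplings μ ν) {p : X → Prop} (hp : ∀ᵐ x ∂μ, p x) : ∀ᵐ z ∂P, p z.1 := by
  rw [← hP.2.1] at hp
  exact ae_of_ae_map measurable_fst.aemeasurable hp

theorem ae_snd_of_mem_couplings {μ : Measure X} {ν : Measure Y} {P : Measure (X × Y)}
    (hP : P ∈ couplings μ ν) {p : Y → Prop} (hp : ∀ᵐ y ∂ν, p y) : ∀ᵐ z ∂P, p z.2 := by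
  rw [← hP.2.2] at hp
  exact ae_of_ae_map measurable_snd.aemeasurable hp

/-- Open sets of the product need not belong to the product σ-field, but their traces on `A ×ˢ B`
do, and this set is conull for every coupling. -/
theorem aemeasurable_of_lowerSemicontinuous {X Y : Type*}
    [MetricSpace X] [MeasurableSpace X] [BorelSpace X]
    [MetricSpace Y] [MeasurableSpace Y] [BorelSpace Y]
    {μ : Measure X} [IsProbabilityMeasure μ] {ν : Measure Y} [IsProbabilityMeasure ν]
    (hsep : SeparableMeasure μ ∨ SeparableMeasure ν) {c : X × Y → ℝ}
    (hc : LowerSemicontinuous c) {P : Measure (X × Y)} (hP : P ∈ couplings μ ν) :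
    AEMeasurable c P := by
  obtain ⟨A, B, hAm, hBm, hA, hB, hrect⟩ := exists_seq_rectangles μ ν hsep
  refine ⟨(A ×ˢ B).indicator c, measurable_of_Ioi fun t => ?_, ?_⟩
  · obtain ⟨U, V, hU, hV, hUV, hW⟩ := hrect _ (hc.isOpen_preimage t)
    have : (A ×ˢ B).indicator c ⁻¹' Ioi t =
        (A ×ˢ B ∩ ⋃ n, U n ×ˢ V n) ∪ ((A ×ˢ B)ᶜ ∩ {_z | t < 0}) := by
      ext ⟨x, y⟩
      by_cases h : (x, y) ∈ A ×ˢ B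
      · simp only [mem_preimage, indicator_of_mem h, mem_union, mem_inter_iff, h, true_and,
          mem_compl_iff, not_true, false_and, or_false, mem_iUnion, mem_prod]
        exact ⟨fun hz => hW x h.1 y h.2 hz, fun ⟨n, hx, hy⟩ => hUV n x y hx hy⟩
      · simp [h]
    rw [this]
    exact ((hAm.prod hBm).inter (.iUnion fun n => (hU n).prod (hV n))).union
      ((hAm.prod hBm).compl.inter (.const _))
  · have hA' : ∀ᵐ x ∂μ, x ∈ A := hA
    have hB' : ∀ᵐ y ∂ν, y ∈ B := hB
    filter_upwards [ae_fst_of_mem_couplings hP hA', ae_snd_of_mem_couplings hP hB'] with z h1 h2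
    rw [indicator_of_mem (show z ∈ A ×ˢ B from ⟨h1, h2⟩)]

/-- Bounded dual potentials pass to the limit along an increasing sequence of costs, up to null
sets. -/
theorem exists_dual_of_monotone (μ : Measure X) [IsProbabilityMeasure μ]
    (ν : Measure Y) [IsProbabilityMeasure ν] {c : ℕ → X → Y → ℝ} (hmono : Monotone c)
    {M r : ℝ} (hM : 0 ≤ M)
    (h : ∀ k, ∃ (f : X → ℝ) (g : Y → ℝ), Measurable f ∧ Measurable g ∧
      (∀ x, f x ∈ Icc 0 M) ∧ (∀ y, g y ∈ Icc 0 M) ∧ (∀ x y, c k x y ≤ f x + g y) ∧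
      ∫ x, f x ∂μ + ∫ y, g y ∂ν ≤ r) :
    ∃ (f : X → ℝ) (g : Y → ℝ) (A : Set X) (B : Set Y), Measurable f ∧ Measurable g ∧
      (∀ x, f x ∈ Icc 0 M) ∧ (∀ y, g y ∈ Icc 0 M) ∧ (∀ᵐ x ∂μ, x ∈ A) ∧ (∀ᵐ y ∂ν, y ∈ B) ∧
      (∀ k, ∀ x ∈ A, ∀ y ∈ B, c k x y ≤ f x + g y) ∧ ∫ x, f x ∂μ + ∫ y, g y ∂ν ≤ r := by
  have hμm : IsProbabilityMeasure (μ.map (Sum.inl : X → X ⊕ Y)) :=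
    Measure.isProbabilityMeasure_map measurable_inl.aemeasurable
  have hνm : IsProbabilityMeasure (ν.map (Sum.inr : Y → X ⊕ Y)) :=
    Measure.isProbabilityMeasure_map measurable_inr.aemeasurable
  -- A pair of potentials is one function on the disjoint sum, so a single L² argument treats both;
  -- m-null sets are null in each factor separately.
  set m : Measure (X ⊕ Y) := μ.map Sum.inl + ν.map Sum.inr with hm
  have hint : ∀ φ : X ⊕ Y → ℝ, Measurable φ → (∀ z, φ z ∈ Icc 0 M) → ∀ ρ : Measure (X ⊕ Y),
      IsFiniteMeasure ρ → Integrable φ ρ := fun φ hφ hb ρ _ =>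
    Integrable.of_bound hφ.aestronglyMeasurable M
      (ae_of_all _ fun z => by rw [Real.norm_of_nonneg (hb z).1]; exact (hb z).2)
  have hsplit : ∀ φ : X ⊕ Y → ℝ, Measurable φ → (∀ z, φ z ∈ Icc 0 M) →
      ∫ z, φ z ∂m = ∫ x, φ (.inl x) ∂μ + ∫ y, φ (.inr y) ∂ν := by
    intro φ hφ hb
    rw [hm, integral_add_measure (hint φ hφ hb _ inferInstance) (hint φ hφ hb _ inferInstance),
      integral_map measurable_inl.aemeasurable hφ.aestronglyMeasurable,
      integral_map measurable_inr.aemeasurable hφ.aestronglyMeasurable]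
  let S : ℕ → Set (Lp ℝ 2 m) := fun k => {h | ∃ φ : X ⊕ Y → ℝ, Measurable φ ∧
    (∀ z, φ z ∈ Icc 0 M) ∧ (∀ x y, c k x y ≤ φ (.inl x) + φ (.inr y)) ∧ ∫ z, φ z ∂m ≤ r ∧
    h =ᵐ[m] φ}
  obtain ⟨h, hmem, hcauchy⟩ := exists_cauchySeq_mem_of_antitone_convex (S := S)
    (fun k l hkl h ⟨φ, h1, h2, h3, h4⟩ =>
      ⟨φ, h1, h2, fun x y => (hmono hkl x y).trans (h3 x y), h4⟩)
    (by
      intro k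
      obtain ⟨f, g, hf, hg, hfM, hgM, hc, hr⟩ := h k
      have hφ : Measurable (Sum.elim f g) := hf.sumElim hg
      have hb : ∀ z, Sum.elim f g z ∈ Icc 0 M := by rintro (x | y); exacts [hfM x, hgM y]
      have hL : MemLp (Sum.elim f g) 2 m := MemLp.of_bound hφ.aestronglyMeasurable M
        (ae_of_all _ fun z => by rw [Real.norm_of_nonneg (hb z).1]; exact (hb z).2)
      refine ⟨hL.toLp _, Sum.elim f g, hφ, hb, hc, ?_, hL.coeFn_toLp⟩
      rw [hsplit _ hφ hb]
      exact hr)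
    (by
      rintro k h ⟨φ, hφ, hb, hc, hr, he⟩ h' ⟨φ', hφ', hb', hc', hr', he'⟩ s t hs ht hst
      refine ⟨s • φ + t • φ', (hφ.const_smul s).add (hφ'.const_smul t),
        fun z => (convex_Icc 0 M) (hb z) (hb' z) hs ht hst, fun x y => ?_, ?_, ?_⟩
      · have h1 := mul_le_mul_of_nonneg_left (hc x y) hs
        have h2 := mul_le_mul_of_nonneg_left (hc' x y) ht
        have h3 : c k x y = s * c k x y + t * c k x y := by rw [← add_mul, hst, one_mul]
        simp only [Pi.add_apply, Pi.smul_apply, smul_eq_mul]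
        linarith
      · have h1 := mul_le_mul_of_nonneg_left hr hs
        have h2 := mul_le_mul_of_nonneg_left hr' ht
        have h3 : r = s * r + t * r := by rw [← add_mul, hst, one_mul]
        simp only [Pi.add_apply, Pi.smul_apply, smul_eq_mul]
        rw [integral_add ((hint φ hφ hb m inferInstance).const_mul s)
          ((hint φ' hφ' hb' m inferInstance).const_mul t), integral_const_mul, integral_const_mul]
        linarith
      · filter_upwards [Lp.coeFn_add (s • h) (t • h'), Lp.coeFn_smul s h, Lp.coeFn_smul t h', he,
          he'] with z h1 h2 h3 h4 h5
        simp only [h1, Pi.add_apply, h2, h3, Pi.smul_apply, h4, h5])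
    (R := (measureUnivNNReal m : ℝ) ^ (2 : ENNReal).toReal⁻¹ * M)
    (by
      rintro k h ⟨φ, hφ, hb, hc, hr, he⟩
      refine Lp.norm_le_of_ae_bound hM ?_
      filter_upwards [he] with z hz
      rw [hz, Real.norm_of_nonneg (hb z).1]
      exact (hb z).2)
  choose φ hφ hb hc hr he using hmem
  obtain ⟨L, hL⟩ := cauchySeq_tendsto_of_complete hcauchy
  obtain ⟨ns, hns, hae⟩ := (tendstoInMeasure_of_tendsto_Lp hL).exists_seq_tendsto_ae
  have hconv : ∀ᵐ z ∂m, Filter.Tendsto (fun i => φ (ns i) z) Filter.atTop (nhds (L z)) := by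
    filter_upwards [hae, ae_all_iff.2 he] with z h1 h2
    simpa only [h2] using h1
  -- Clamping gives the bounds everywhere and changes nothing where the subsequence converges.
  set ψ : X ⊕ Y → ℝ := fun z => max 0 (min M (L z)) with hψ
  have hLm : Measurable L := (Lp.stronglyMeasurable L).measurable
  have hψm : Measurable ψ := measurable_const.max (measurable_const.min hLm)
  have hψb : ∀ z, ψ z ∈ Icc 0 M := fun z => ⟨le_max_left _ _, max_le hM (min_le_left _ _)⟩
  have hψL : ∀ z, Filter.Tendsto (fun i => φ (ns i) z) Filter.atTop (nhds (L z)) →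
      Filter.Tendsto (fun i => φ (ns i) z) Filter.atTop (nhds (ψ z)) := by
    intro z hz
    have h1 : L z ∈ Icc 0 M := isClosed_Icc.mem_of_tendsto hz (.of_forall fun i => hb _ z)
    have h2 : ψ z = L z := by simp only [hψ, min_eq_right h1.2, max_eq_right h1.1]
    rwa [h2]
  have hψr : ∫ z, ψ z ∂m ≤ r := by
    refine le_of_tendsto (tendsto_integral_of_dominated_convergence (fun _ => M)
      (fun i => (hφ (ns i)).aestronglyMeasurable) (integrable_const M)
      (fun i => ae_of_all _ fun z => ?_) (hconv.mono hψL)) (.of_forall fun i => hr (ns i))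
    rw [Real.norm_of_nonneg (hb _ z).1]
    exact (hb _ z).2
  have hconv' := ae_add_measure_iff.1 hconv
  refine ⟨fun x => ψ (.inl x), fun y => ψ (.inr y), _, _, hψm.comp measurable_inl,
    hψm.comp measurable_inr, fun x => hψb _, fun y => hψb _,
    ae_of_ae_map measurable_inl.aemeasurable hconv'.1,
    ae_of_ae_map measurable_inr.aemeasurable hconv'.2, fun k x hx y hy => ?_, ?_⟩
  · refine ge_of_tendsto ((hψL _ hx).add (hψL _ hy)) ?_
    -- A strictly increasing `ns` satisfies i ≤ ns i, so the k-th constraint holds along the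
    -- subsequence from i = k on.
    filter_upwards [Filter.eventually_ge_atTop k] with i hi
    exact (hmono (hi.trans (hns.id_le i)) x y).trans (hc _ x y)
  · rw [← hsplit ψ hψm hψb]
    exact hψr

/-- Dual potentials for a cost with values in `[0, M]` may be normalised to have values in
`[0, M]`. -/
theorem exists_truncation_of_dual {X Y : Type*} [Nonempty X] [Nonempty Y] {f : X → ℝ} {g : Y → ℝ}
    {c : X → Y → ℝ} {M : ℝ} (hc : ∀ x y, c x y ∈ Icc 0 M) (hfg : ∀ x y, c x y ≤ f x + g y) :
    ∃ s : ℝ, (∀ x, min (f x - s) M ∈ Icc 0 M) ∧ (∀ y, min (g y + s) M ∈ Icc 0 M) ∧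
      ∀ x y, c x y ≤ min (f x - s) M + min (g y + s) M := by
  obtain ⟨x₀⟩ := ‹Nonempty X›
  obtain ⟨y₀⟩ := ‹Nonempty Y›
  have hM : 0 ≤ M := (hc x₀ y₀).1.trans (hc x₀ y₀).2
  have hbdd : BddBelow (range f) := by
    refine ⟨-g y₀, ?_⟩
    rintro _ ⟨x, rfl⟩
    linarith [hfg x y₀, (hc x y₀).1]
  have hne : Nonempty X := ⟨x₀⟩
  have hf : ∀ x, 0 ≤ f x - ⨅ x, f x := fun x => sub_nonneg.2 (ciInf_le hbdd x)
  have hg : ∀ y, 0 ≤ g y + ⨅ x, f x := by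
    intro y
    have : -g y ≤ ⨅ x, f x := le_ciInf fun x => by linarith [hfg x y, (hc x y).1]
    linarith
  -- Shifting by inf f makes both potentials nonnegative, the second one because c ≥ 0. If either is
  -- capped at M, the sum is still at least M ≥ c.
  refine ⟨⨅ x, f x, fun x => ⟨le_min (hf x) hM, min_le_right _ _⟩,
    fun y => ⟨le_min (hg y) hM, min_le_right _ _⟩, fun x y => ?_⟩
  have h1 := (hc x y).2
  have h2 := hfg x y
  have h3 := hf x
  have h4 := hg y
  rcases min_cases (f x - ⨅ x, f x) M with h | h <;>
    rcases min_cases (g y + ⨅ x, f x) M with h' | h' <;> linarith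

/-- The normalising shift cancels in the sum because both measures have mass one, and capping only
lowers the integrals. -/
theorem exists_bounded_dual_of_finite_partition {I J : Type*}
    [Fintype I] [MeasurableSpace I] [MeasurableSingletonClass I]
    [Fintype J] [MeasurableSpace J] [MeasurableSingletonClass J]
    (μ : Measure X) [IsProbabilityMeasure μ] (ν : Measure Y) [IsProbabilityMeasure ν]
    {i : X → I} (hi : Measurable i) {j : Y → J} (hj : Measurable j) (C : I → J → ℝ) {M r : ℝ}
    (hC : ∀ x y, C (i x) (j y) ∈ Icc 0 M)
    (hr : ∀ P ∈ couplings μ ν, ∫ z, C (i z.1) (j z.2) ∂P < r) :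
    ∃ (f : X → ℝ) (g : Y → ℝ), Measurable f ∧ Measurable g ∧
      (∀ x, f x ∈ Icc 0 M) ∧ (∀ y, g y ∈ Icc 0 M) ∧ (∀ x y, C (i x) (j y) ≤ f x + g y) ∧
      ∫ x, f x ∂μ + ∫ y, g y ∂ν ≤ r := by
  obtain ⟨u, v, huv, hlt⟩ := exists_dual_of_finite_partition μ ν hi hj C hr
  have : Nonempty X := nonempty_of_isProbabilityMeasure μ
  have : Nonempty Y := nonempty_of_isProbabilityMeasure ν
  obtain ⟨s, hf, hg, hfg⟩ := exists_truncation_of_dual (c := fun x y => C (i x) (j y))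
    (f := fun x => u (i x)) (g := fun y => v (j y)) hC fun x y => huv _ _
  have hum : Measurable fun x => u (i x) := (measurable_of_finite u).comp hi
  have hvm : Measurable fun y => v (j y) := (measurable_of_finite v).comp hj
  have hfm : Measurable fun x => min (u (i x) - s) M := (hum.sub_const s).min measurable_const
  have hgm : Measurable fun y => min (v (j y) + s) M := (hvm.add_const s).min measurable_const
  refine ⟨_, _, hfm, hgm, hf, hg, hfg, ?_⟩
  have hui : Integrable (fun x => u (i x)) μ :=
    Integrable.of_bound hum.aestronglyMeasurable (∑ a, ‖u a‖) (ae_of_all _ fun x =>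
      Finset.single_le_sum (f := fun a => ‖u a‖) (fun a _ => norm_nonneg _) (Finset.mem_univ _))
  have hvi : Integrable (fun y => v (j y)) ν :=
    Integrable.of_bound hvm.aestronglyMeasurable (∑ b, ‖v b‖) (ae_of_all _ fun y =>
      Finset.single_le_sum (f := fun b => ‖v b‖) (fun b _ => norm_nonneg _) (Finset.mem_univ _))
  have h1 : ∫ x, min (u (i x) - s) M ∂μ ≤ ∫ x, (u (i x) - s) ∂μ :=
    integral_mono ((hui.sub (integrable_const s)).inf (integrable_const M))
      (hui.sub (integrable_const s)) fun x => min_le_left _ _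
  have h2 : ∫ y, min (v (j y) + s) M ∂ν ≤ ∫ y, (v (j y) + s) ∂ν :=
    integral_mono ((hvi.add (integrable_const s)).inf (integrable_const M))
      (hvi.add (integrable_const s)) fun y => min_le_left _ _
  rw [integral_sub hui (integrable_const s), integral_const] at h1
  rw [integral_add hvi (integrable_const s), integral_const] at h2
  simp only [probReal_univ, one_smul] at h1 h2
  linarith

end KantorovichDuality
-- Integration against couplings
namespace KantorovichDuality

section Integrability
variable {X Y : Type*} [MeasurableSpace X] [MeasurableSpace Y] {μ : Measure X} {ν : Measure Y}
  {P : Measure (X × Y)}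

theorem integrable_comp_fst_of_mem_couplings (hP : P ∈ couplings μ ν) {f : X → ℝ}
    (hf : Integrable f μ) : Integrable (fun z => f z.1) P := by
  rw [← hP.2.1] at hf
  exact hf.comp_measurable measurable_fst

theorem integrable_comp_snd_of_mem_couplings (hP : P ∈ couplings μ ν) {g : Y → ℝ}
    (hg : Integrable g ν) : Integrable (fun z => g z.2) P := by
  rw [← hP.2.2] at hg
  exact hg.comp_measurable measurable_snd

theorem integral_comp_fst_of_mem_couplings (hP : P ∈ couplings μ ν) {f : X → ℝ}
    (hf : Integrable f μ) : ∫ z, f z.1 ∂P = ∫ x, f x ∂μ := by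
  rw [← hP.2.1] at hf ⊢
  exact (integral_map measurable_fst.aemeasurable hf.aestronglyMeasurable).symm

theorem integral_comp_snd_of_mem_couplings (hP : P ∈ couplings μ ν) {g : Y → ℝ}
    (hg : Integrable g ν) : ∫ z, g z.2 ∂P = ∫ y, g y ∂ν := by
  rw [← hP.2.2] at hg ⊢
  exact (integral_map measurable_snd.aemeasurable hg.aestronglyMeasurable).symm

theorem integral_add_of_mem_couplings (hP : P ∈ couplings μ ν) {f : X → ℝ} {g : Y → ℝ}
    (hf : Integrable f μ) (hg : Integrable g ν) :
    ∫ z, (f z.1 + g z.2) ∂P = ∫ x, f x ∂μ + ∫ y, g y ∂ν := by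
  rw [integral_add (integrable_comp_fst_of_mem_couplings hP hf)
    (integrable_comp_snd_of_mem_couplings hP hg), integral_comp_fst_of_mem_couplings hP hf,
    integral_comp_snd_of_mem_couplings hP hg]

theorem IntegrableBounds.exists_abs_le {c : X × Y → ℝ} (hc : IntegrableBounds μ ν c) :
    ∃ F ∈ L1 μ, ∃ G ∈ L1 ν, ∀ x y, |c (x, y)| ≤ F x + G y := by
  obtain ⟨f₁, hf₁, g₁, hg₁, f₂, hf₂, g₂, hg₂, h⟩ := hc
  refine ⟨fun x => |f₁ x| + |f₂ x|, ⟨hf₁.1.abs.add hf₂.1.abs, hf₁.2.abs.add hf₂.2.abs⟩,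
    fun y => |g₁ y| + |g₂ y|, ⟨hg₁.1.abs.add hg₂.1.abs, hg₁.2.abs.add hg₂.2.abs⟩, fun x y => ?_⟩
  obtain ⟨h1, h2⟩ := h x y
  rw [abs_le]
  constructor <;> linarith [neg_abs_le (f₁ x), neg_abs_le (g₁ y), le_abs_self (f₂ x),
    le_abs_self (g₂ y), abs_nonneg (f₁ x), abs_nonneg (f₂ x), abs_nonneg (g₁ y),
    abs_nonneg (g₂ y)]

theorem IntegrableBounds.integrable {c : X × Y → ℝ} (hc : IntegrableBounds μ ν c)
    (hP : P ∈ couplings μ ν) (hm : AEMeasurable c P) : Integrable c P := by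
  obtain ⟨F, hF, G, hG, h⟩ := hc.exists_abs_le
  exact ((integrable_comp_fst_of_mem_couplings hP hF.2).add
    (integrable_comp_snd_of_mem_couplings hP hG.2)).mono' hm.aestronglyMeasurable
    (ae_of_all _ fun z => h z.1 z.2)

theorem IntegrableBounds.neg {c : X × Y → ℝ} (hc : IntegrableBounds μ ν c) :
    IntegrableBounds μ ν (-c) := by
  obtain ⟨f₁, hf₁, g₁, hg₁, f₂, hf₂, g₂, hg₂, h⟩ := hc
  refine ⟨-f₂, ⟨hf₂.1.neg, hf₂.2.neg⟩, -g₂, ⟨hg₂.1.neg, hg₂.2.neg⟩, -f₁, ⟨hf₁.1.neg, hf₁.2.neg⟩,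
    -g₁, ⟨hg₁.1.neg, hg₁.2.neg⟩, fun x y => ?_⟩
  obtain ⟨h1, h2⟩ := h x y
  simp only [Pi.neg_apply]
  constructor <;> linarith

theorem tendsto_integral_excess [IsFiniteMeasure μ] {F : X → ℝ} (hF : F ∈ L1 μ) :
    Filter.Tendsto (fun n : ℕ => ∫ x, max (F x - n) 0 ∂μ) Filter.atTop (nhds 0) := by
  suffices h : Filter.Tendsto (fun n : ℕ => ∫ x, max (F x - n) 0 ∂μ) Filter.atTop
      (nhds (∫ _, (0 : ℝ) ∂μ)) by rwa [integral_zero] at h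
  refine tendsto_integral_of_dominated_convergence (fun x => |F x|)
    (fun n => ((hF.1.sub_const _).max measurable_const).aestronglyMeasurable) hF.2.abs
    (fun n => ae_of_all _ fun x => ?_) (ae_of_all _ fun x => ?_)
  · rw [Real.norm_of_nonneg (le_max_right _ _)]
    exact max_le (by linarith [le_abs_self (F x), (Nat.cast_nonneg n : (0 : ℝ) ≤ n)])
      (abs_nonneg _)
  · obtain ⟨N, hN⟩ := exists_nat_ge (F x)
    refine tendsto_const_nhds.congr' ?_
    filter_upwards [Filter.eventually_ge_atTop N] with n hn
    have : (N : ℝ) ≤ n := Nat.cast_le.2 hn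
    exact (max_eq_right (by linarith)).symm

theorem integral_lt_of_alphaStar_lt {c : X × Y → ℝ} {r : ℝ} (h : alphaStar μ ν c < r)
    (P : Measure (X × Y)) (hP : P ∈ couplings μ ν) : ∫ z, c z ∂P < r :=
  EReal.coe_lt_coe_iff.1 (lt_of_le_of_lt
    (le_iSup₂ (f := fun P (_ : P ∈ couplings μ ν) => ((∫ z, c z ∂P : ℝ) : EReal)) P hP) h)

theorem lt_integral_of_lt_alpha {c : X × Y → ℝ} {r : ℝ} (h : r < alpha μ ν c)
    (P : Measure (X × Y)) (hP : P ∈ couplings μ ν) : r < ∫ z, c z ∂P :=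
  EReal.coe_lt_coe_iff.1 (lt_of_lt_of_le h
    (iInf₂_le (f := fun P (_ : P ∈ couplings μ ν) => ((∫ z, c z ∂P : ℝ) : EReal)) P hP))

end Integrability

/-! ### Duality for semicontinuous costs -/

variable {X Y : Type*}
  [MetricSpace X] [MeasurableSpace X] [BorelSpace X]
  [MetricSpace Y] [MeasurableSpace Y] [BorelSpace Y]
  {μ : Measure X} [IsProbabilityMeasure μ] {ν : Measure Y} [IsProbabilityMeasure ν]

open scoped Classical in
theorem exists_dual_of_bounded_lowerSemicontinuous
    (hsep : SeparableMeasure μ ∨ SeparableMeasure ν) {c : X × Y → ℝ}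
    (hc : LowerSemicontinuous c) {M r : ℝ} (hb : ∀ z, c z ∈ Icc 0 M)
    (hr : ∀ P ∈ couplings μ ν, ∫ z, c z ∂P < r) :
    ∃ f ∈ L1 μ, ∃ g ∈ L1 ν, (∀ x y, c (x, y) ≤ f x + g y) ∧
      ∫ x, f x ∂μ + ∫ y, g y ∂ν ≤ r := by
  obtain ⟨x₀⟩ := nonempty_of_isProbabilityMeasure μ
  obtain ⟨y₀⟩ := nonempty_of_isProbabilityMeasure ν
  have hM : 0 ≤ M := (hb (x₀, y₀)).1.trans (hb (x₀, y₀)).2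
  obtain ⟨A, B, -, -, hA, hB, hrect⟩ := exists_seq_rectangles μ ν hsep
  set t := TopologicalSpace.denseSeq ℝ
  choose U V hU hV hUV hW using fun l => hrect _ (hc.isOpen_preimage (t l))
  -- The index m codes a pair (level, rectangle). Levels are clipped at 0 so that the approximating
  -- costs are nonnegative.
  let T : ℕ → ℝ := fun m => max (t m.unpair.1) 0
  -- The label of a point records which of the first k + 1 sets contain it; there are finitely many
  -- labels.
  let i : ∀ k : ℕ, X → Fin (k + 1) → Prop := fun k x n => x ∈ U n.1.unpair.1 n.1.unpair.2
  let j : ∀ k : ℕ, Y → Fin (k + 1) → Prop := fun k y n => y ∈ V n.1.unpair.1 n.1.unpair.2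
  have hi : ∀ k, Measurable (i k) := fun k =>
    measurable_pi_lambda _ fun n => measurableSet_setOfPred.1 (hU _ _)
  have hj : ∀ k, Measurable (j k) := fun k =>
    measurable_pi_lambda _ fun n => measurableSet_setOfPred.1 (hV _ _)
  let C : ∀ k : ℕ, (Fin (k + 1) → Prop) → (Fin (k + 1) → Prop) → ℝ := fun k a b =>
    Finset.univ.sup' Finset.univ_nonempty fun n => if a n ∧ b n then T n else 0
  have hterm : ∀ k x y (n : Fin (k + 1)),
      (if i k x n ∧ j k y n then T n else 0) ≤ C k (i k x) (j k y) := fun k x y n =>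
    Finset.le_sup' (fun n => if i k x n ∧ j k y n then T n else 0) (Finset.mem_univ n)
  have hCc : ∀ k x y, C k (i k x) (j k y) ≤ c (x, y) := by
    intro k x y
    refine Finset.sup'_le _ _ fun n _ => ?_
    split_ifs with h
    · exact max_le (hUV _ _ x y h.1 h.2).le (hb _).1
    · exact (hb _).1
  have hC0 : ∀ k x y, 0 ≤ C k (i k x) (j k y) := by
    intro k x y
    refine le_trans ?_ (hterm k x y 0)
    split_ifs
    exacts [le_max_right _ _, le_rfl]
  have hmono : Monotone fun k x y => C k (i k x) (j k y) := fun k l hkl x y =>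
    Finset.sup'_le _ _ fun n _ => hterm l x y (Fin.castLE (by omega) n)
  obtain ⟨f, g, A', B', hf, hg, hfM, hgM, hA', hB', hfg, hle⟩ :=
    exists_dual_of_monotone μ ν hmono hM (r := r) fun k =>
      exists_bounded_dual_of_finite_partition μ ν (hi k) (hj k) (C k)
        (fun x y => ⟨hC0 k x y, (hCc k x y).trans (hb _).2⟩) fun P hP => by
          refine lt_of_le_of_lt ?_ (hr P hP)
          have := hP.1
          refine integral_mono_of_nonneg (ae_of_all _ fun z => hC0 k z.1 z.2) ?_
            (ae_of_all _ fun z => hCc k z.1 z.2)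
          refine Integrable.of_bound
            (aemeasurable_of_lowerSemicontinuous hsep hc hP).aestronglyMeasurable M
            (ae_of_all _ fun z => ?_)
          rw [Real.norm_of_nonneg (hb z).1]
          exact (hb z).2
  have hlim : ∀ x ∈ A, x ∈ A' → ∀ y ∈ B, y ∈ B' → c (x, y) ≤ f x + g y := by
    intro x hx hx' y hy hy'
    refine le_of_forall_lt fun s hs => ?_
    obtain ⟨l, hl⟩ := (TopologicalSpace.denseRange_denseSeq ℝ).exists_mem_open isOpen_Ioo
      (nonempty_Ioo.2 hs)
    obtain ⟨n, hxn, hyn⟩ := hW l x hx y hy hl.2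
    -- The rectangle coded by `Nat.pair l n` is the last term of the approximation with this index.
    have h1 := hterm (Nat.pair l n) x y (Fin.last _)
    have h2 : i (Nat.pair l n) x (Fin.last _) ∧ j (Nat.pair l n) y (Fin.last _) := by
      simp only [i, j, Fin.val_last, Nat.unpair_pair]
      exact ⟨hxn, hyn⟩
    rw [if_pos h2] at h1
    have h3 : t l ≤ T (Fin.last (Nat.pair l n)).1 := by
      simp only [T, Fin.val_last, Nat.unpair_pair]
      exact le_max_left _ _
    exact hl.1.trans_le (h3.trans (h1.trans (hfg _ x hx' y hy')))
  -- Raising a potential to M on a measurable null set secures the inequality there, since c ≤ M and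
  -- the other potential is nonnegative.
  set N := toMeasurable μ (A ∩ A')ᶜ with hN
  set N' := toMeasurable ν (B ∩ B')ᶜ with hN'
  have hN0 : μ N = 0 := by
    rw [hN, measure_toMeasurable, compl_inter]
    exact measure_union_null hA hA'
  have hN'0 : ν N' = 0 := by
    rw [hN', measure_toMeasurable, compl_inter]
    exact measure_union_null hB hB'
  have hNm : MeasurableSet N := measurableSet_toMeasurable _ _
  have hN'm : MeasurableSet N' := measurableSet_toMeasurable _ _
  have hfe : N.piecewise (fun _ => M) f =ᵐ[μ] f := by
    filter_upwards [measure_eq_zero_iff_ae_notMem.1 hN0] with x hx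
    exact piecewise_eq_of_notMem _ _ _ hx
  have hge : N'.piecewise (fun _ => M) g =ᵐ[ν] g := by
    filter_upwards [measure_eq_zero_iff_ae_notMem.1 hN'0] with y hy
    exact piecewise_eq_of_notMem _ _ _ hy
  have hfi : Integrable f μ := Integrable.of_bound hf.aestronglyMeasurable M
    (ae_of_all _ fun x => by rw [Real.norm_of_nonneg (hfM x).1]; exact (hfM x).2)
  have hgi : Integrable g ν := Integrable.of_bound hg.aestronglyMeasurable M
    (ae_of_all _ fun y => by rw [Real.norm_of_nonneg (hgM y).1]; exact (hgM y).2)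
  refine ⟨N.piecewise (fun _ => M) f, ⟨measurable_const.piecewise hNm hf, hfi.congr hfe.symm⟩,
    N'.piecewise (fun _ => M) g, ⟨measurable_const.piecewise hN'm hg, hgi.congr hge.symm⟩,
    fun x y => ?_, ?_⟩
  · have hcM := (hb (x, y)).2
    by_cases hx : x ∈ N
    · by_cases hy : y ∈ N'
      · rw [piecewise_eq_of_mem _ _ _ hx, piecewise_eq_of_mem _ _ _ hy]
        linarith
      · rw [piecewise_eq_of_mem _ _ _ hx, piecewise_eq_of_notMem _ _ _ hy]
        linarith [(hgM y).1]
    · by_cases hy : y ∈ N'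
      · rw [piecewise_eq_of_notMem _ _ _ hx, piecewise_eq_of_mem _ _ _ hy]
        linarith [(hfM x).1]
      · rw [piecewise_eq_of_notMem _ _ _ hx, piecewise_eq_of_notMem _ _ _ hy]
        have hx' := notMem_compl_iff.1 fun h => hx (subset_toMeasurable μ _ h)
        have hy' := notMem_compl_iff.1 fun h => hy (subset_toMeasurable ν _ h)
        exact hlim x hx'.1 hx'.2 y hy'.1 hy'.2
  · rw [integral_congr_ae hfe, integral_congr_ae hge]
    exact hle

theorem exists_dual_of_lowerSemicontinuous
    (hsep : SeparableMeasure μ ∨ SeparableMeasure ν) {c : X × Y → ℝ}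
    (hbd : IntegrableBounds μ ν c) (hc : LowerSemicontinuous c) {r ε : ℝ} (hε : 0 < ε)
    (hr : ∀ P ∈ couplings μ ν, ∫ z, c z ∂P < r) :
    ∃ f ∈ L1 μ, ∃ g ∈ L1 ν, (∀ x y, c (x, y) ≤ f x + g y) ∧
      ∫ x, f x ∂μ + ∫ y, g y ∂ν ≤ r + ε := by
  obtain ⟨F, hF, G, hG, hFG⟩ := hbd.exists_abs_le
  have hε4 : (0 : ℝ) < ε / 4 := by positivity
  obtain ⟨m, hm1, hm2⟩ := (((tendsto_integral_excess hF).eventually (gt_mem_nhds hε4)).and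
    ((tendsto_integral_excess hG).eventually (gt_mem_nhds hε4))).exists
  set a : X → ℝ := fun x => max (F x - m) 0
  set b : Y → ℝ := fun y => max (G y - m) 0
  have ha : a ∈ L1 μ :=
    ⟨(hF.1.sub_const _).max measurable_const, (hF.2.sub (integrable_const _)).sup
      (integrable_const _)⟩
  have hb : b ∈ L1 ν :=
    ⟨(hG.1.sub_const _).max measurable_const, (hG.2.sub (integrable_const _)).sup
      (integrable_const _)⟩
  -- `T` clamps c + 2m to [0, 4m], that is, c to [-2m, 2m]. As |c| ≤ F + G ≤ 2m + a + b, this moves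
  -- c by at most a + b.
  set T : ℝ → ℝ := fun s => max 0 (min (4 * m) (s + 2 * m)) with hT
  have hTc : Continuous T := by fun_prop
  have hTmono : Monotone T := fun s s' hs => by simp only [hT]; gcongr
  have hm0 : (0 : ℝ) ≤ m := Nat.cast_nonneg m
  have hbound : ∀ x y, |c (x, y) + 2 * m - T (c (x, y))| ≤ a x + b y := by
    intro x y
    have h1 := abs_le.1 (hFG x y)
    have h2 : F x - m ≤ a x := le_max_left _ _
    have h3 : G y - m ≤ b y := le_max_left _ _
    have h4 : 0 ≤ a x := le_max_right _ _
    have h5 : 0 ≤ b y := le_max_right _ _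
    rw [abs_le]
    simp only [hT]
    rcases min_cases (4 * (m : ℝ)) (c (x, y) + 2 * m) with h | h <;>
      rcases max_cases 0 (min (4 * (m : ℝ)) (c (x, y) + 2 * m)) with h' | h' <;>
      constructor <;> linarith
  have hTlsc : LowerSemicontinuous fun z => T (c z) := hTc.comp_lowerSemicontinuous hc hTmono
  have hTb : ∀ s, T s ∈ Icc 0 (4 * (m : ℝ)) := fun s =>
    ⟨le_max_left _ _, max_le (by positivity) (min_le_left _ _)⟩
  obtain ⟨f, hf, g, hg, hfg, hle⟩ := exists_dual_of_bounded_lowerSemicontinuous hsep hTlsc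
    -- The clamping error, less than ε/2 in integral, is paid twice: here, and when a and b are
    -- added back to the potentials.
    (r := r + 2 * m + ε / 2) (fun z => hTb _) (by
      intro P hP
      have := hP.1
      have hci := hbd.integrable hP (aemeasurable_of_lowerSemicontinuous hsep hc hP)
      have hai := integrable_comp_fst_of_mem_couplings hP ha.2
      have hbi := integrable_comp_snd_of_mem_couplings hP hb.2
      have hcm : Integrable (fun z => c z + 2 * (m : ℝ)) P := hci.add (integrable_const _)
      have hab : Integrable (fun z : X × Y => a z.1 + b z.2) P := hai.add hbi
      have h1 : ∫ z, T (c z) ∂P ≤ ∫ z, ((c z + 2 * m) + (a z.1 + b z.2)) ∂P := by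
        refine integral_mono_of_nonneg (ae_of_all _ fun z => (hTb _).1)
          (hcm.add hab) (ae_of_all _ fun z => ?_)
        have := (abs_le.1 (hbound z.1 z.2)).1
        simp only
        linarith
      rw [integral_add hcm hab,
        integral_add hci (integrable_const _), integral_add_of_mem_couplings hP ha.2 hb.2,
        integral_const, probReal_univ, one_smul] at h1
      linarith [hr P hP])
  refine ⟨fun x => f x - 2 * m + a x, ⟨(hf.1.sub_const _).add ha.1,
    (hf.2.sub (integrable_const _)).add ha.2⟩, fun y => g y + b y,
    ⟨hg.1.add hb.1, hg.2.add hb.2⟩, fun x y => ?_, ?_⟩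
  · have h1 := (abs_le.1 (hbound x y)).2
    have h2 := hfg x y
    linarith
  · have hfm : Integrable (fun x => f x - 2 * (m : ℝ)) μ := hf.2.sub (integrable_const _)
    rw [integral_add hfm ha.2, integral_sub hf.2 (integrable_const _),
      integral_add hg.2 hb.2, integral_const, probReal_univ, one_smul]
    linarith

theorem alphaStar_eq_betaStar_of_lowerSemicontinuous
    (hsep : SeparableMeasure μ ∨ SeparableMeasure ν) {c : X × Y → ℝ}
    (hbd : IntegrableBounds μ ν c) (hc : LowerSemicontinuous c) :
    alphaStar μ ν c = betaStar μ ν c := by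
  refine le_antisymm ?_ ?_
  · refine iSup₂_le fun P hP => le_sInf ?_
    rintro _ ⟨f, hf, g, hg, hfg, rfl⟩
    rw [EReal.coe_le_coe_iff, ← integral_add_of_mem_couplings hP hf.2 hg.2]
    exact integral_mono (hbd.integrable hP (aemeasurable_of_lowerSemicontinuous hsep hc hP))
      ((integrable_comp_fst_of_mem_couplings hP hf.2).add
        (integrable_comp_snd_of_mem_couplings hP hg.2)) fun z => hfg z.1 z.2
  · refine le_of_forall_gt fun b hb => ?_
    -- Two reals are inserted: r bounds the integrals over couplings, and r' - r is the loss ε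
    -- allowed to the potentials.
    obtain ⟨r', h1, h2⟩ := EReal.lt_iff_exists_real_btwn.1 hb
    obtain ⟨r, h3, h4⟩ := EReal.lt_iff_exists_real_btwn.1 h1
    have h4' : r < r' := EReal.coe_lt_coe_iff.1 h4
    obtain ⟨f, hf, g, hg, hfg, hle⟩ := exists_dual_of_lowerSemicontinuous hsep hbd hc
      (sub_pos.2 h4') (integral_lt_of_alphaStar_lt h3)
    refine lt_of_le_of_lt ((show betaStar μ ν c ≤ _ from
      sInf_le ⟨f, hf, g, hg, hfg, rfl⟩).trans ?_) h2
    exact EReal.coe_le_coe_iff.2 (by linarith)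

theorem alpha_eq_beta_of_upperSemicontinuous
    (hsep : SeparableMeasure μ ∨ SeparableMeasure ν) {c : X × Y → ℝ}
    (hbd : IntegrableBounds μ ν c) (hc : UpperSemicontinuous c)
    (hint : ∀ P ∈ couplings μ ν, Integrable c P) :
    alpha μ ν c = beta μ ν c := by
  have hneg : LowerSemicontinuous (-c) :=
    continuous_neg.comp_upperSemicontinuous_antitone hc fun _ _ => neg_le_neg
  refine le_antisymm ?_ ?_
  · refine le_of_forall_lt fun b hb => ?_
    obtain ⟨r', h1, h2⟩ := EReal.lt_iff_exists_real_btwn.1 hb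
    obtain ⟨r, h3, h4⟩ := EReal.lt_iff_exists_real_btwn.1 h2
    have h3' : r' < r := EReal.coe_lt_coe_iff.1 h3
    obtain ⟨f, hf, g, hg, hfg, hle⟩ := exists_dual_of_lowerSemicontinuous hsep hbd.neg hneg
      (r := -r) (sub_pos.2 h3') fun P hP => by
        simp only [Pi.neg_apply, integral_neg]
        linarith [lt_integral_of_lt_alpha h4 P hP]
    have hfg' : ∀ x y, -f x + -g y ≤ c (x, y) := by
      intro x y
      have := hfg x y
      simp only [Pi.neg_apply] at this
      linarith
    refine lt_of_lt_of_le h1 (le_trans ?_ (show _ ≤ beta μ ν c from le_sSup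
      ⟨fun x => -f x, ⟨hf.1.neg, hf.2.neg⟩, fun y => -g y, ⟨hg.1.neg, hg.2.neg⟩, hfg', rfl⟩))
    rw [EReal.coe_le_coe_iff, integral_neg, integral_neg]
    linarith
  · refine sSup_le ?_
    rintro _ ⟨f, hf, g, hg, hfg, rfl⟩
    refine le_iInf₂ fun P hP => ?_
    rw [EReal.coe_le_coe_iff, ← integral_add_of_mem_couplings hP hf.2 hg.2]
    exact integral_mono ((integrable_comp_fst_of_mem_couplings hP hf.2).add
      (integrable_comp_snd_of_mem_couplings hP hg.2)) (hint P hP) fun z => hfg z.1 z.2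

end KantorovichDuality

theorem theorem3p5 {X Y : Type*}
    [MetricSpace X] [MeasurableSpace X] [BorelSpace X]
    [MetricSpace Y] [MeasurableSpace Y] [BorelSpace Y]
    (μ : Measure X) [IsProbabilityMeasure μ] (ν : Measure Y) [IsProbabilityMeasure ν]
    (c : X × Y → ℝ) (hc : KantorovichDuality.IntegrableBounds μ ν c)
    (hsep : KantorovichDuality.SeparableMeasure μ ∨ KantorovichDuality.SeparableMeasure ν) :
    (LowerSemicontinuous c →
      (∀ P ∈ KantorovichDuality.couplings μ ν, Integrable c P) ∧
        KantorovichDuality.alphaStar μ ν c = KantorovichDuality.betaStar μ ν c) ∧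
    (UpperSemicontinuous c →
      (∀ P ∈ KantorovichDuality.couplings μ ν, Integrable c P) ∧
        KantorovichDuality.alpha μ ν c = KantorovichDuality.beta μ ν c) := by
  refine ⟨fun h => ⟨fun P hP => ?_, ?_⟩, fun h => ?_⟩
  · exact hc.integrable hP (KantorovichDuality.aemeasurable_of_lowerSemicontinuous hsep h hP)
  · exact KantorovichDuality.alphaStar_eq_betaStar_of_lowerSemicontinuous hsep hc h
  · have hneg : LowerSemicontinuous (-c) :=
      continuous_neg.comp_upperSemicontinuous_antitone h fun _ _ => neg_le_neg
    have hint : ∀ P ∈ KantorovichDuality.couplings μ ν, Integrable c P := fun P hP =>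
      integrable_neg_iff.1 (hc.neg.integrable hP
        (KantorovichDuality.aemeasurable_of_lowerSemicontinuous hsep hneg hP))
    exact ⟨hint, KantorovichDuality.alpha_eq_beta_of_upperSemicontinuous hsep hc h hint⟩
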